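/- Let $n \ge 0$ be an integer, let $H \in \mathbb{R}^{n\times n}$ be symmetric positive semidefinite, let $\gamma > 0$, $g \in \mathbb{R}^n$ and $\theta \in [0,1)$, and set $\kappa = \frac{\|H\|+\gamma}{\gamma}$, where $\|\cdot\|$ denotes the Euclidean norm of vectors and the spectral norm of matrices. (In particular, $g=g_k$, $H=H_k$ and $\gamma=\gamma_k$ may be the gradient, the positive semidefinite model matrix and the regularization parameter at any iteration $k$ of a quadratic regularization method.) Apply the conjugate gradient method, started at $s^{(0)} = 0$ and stopped if its residual vanishes, to the linear system $(H+\gamma I)s = -g$. Then the method computes an iterate $s^{(q)}$ that satisfies the inexactness condition \[ (H+\gamma I)s^{(q)} = -g + t, \qquad \|t\| \le \theta\sqrt{\frac{\gamma}{\|H\|+\gamma}}\;\|g\| \] for some $t \in \mathbb{R}^n$, after a number $q$ of iterations with \[ q \le \min\left\{ n,\ \left\lceil \tfrac12\sqrt{\kappa}\,\log\!\left(\frac{2\kappa}{\theta}\right)\right\rceil \right\}, \] where for $\theta = 0$ the second term is $+\infty$, so that the bound is $n$. These $q$ iterations use exactly $q$ products of a vector with the matrix $H+\gamma I$. -/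

import Mathlib

/-- Programs that access a linear system's matrix only by requesting matrix-vector products:
either stop with an output, or request the product with `v` and continue with the answer. -/
inductive MatVecProg (V α : Type) : Type
  | done (a : α) : MatVecProg V α
  | mul (v : V) (cont : V → MatVecProg V α) : MatVecProg V α

namespace MatVecProg

/-- Sequential composition of programs. -/
def bind {V α β : Type} : MatVecProg V α → (α → MatVecProg V β) → MatVecProg V β
  | done a, f => f a
  | mul v cont, f => mul v (fun w => (cont w).bind f)

/-- The output of a program when products are answered by `A`. -/
def output {V α : Type} (A : V → V) : MatVecProg V α → α
  | done a => a
  | mul v cont => (cont (A v)).output A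

/-- The number of products requested by a program when products are answered by `A`. -/
def products {V α : Type} (A : V → V) : MatVecProg V α → ℕ
  | done _ => 0
  | mul v cont => (cont (A v)).products A + 1

end MatVecProg

/-- The vectors kept by the conjugate gradient method for `A x = b`: the iterate `x`, the
residual `r = A x - b`, and the search direction `p`. -/
structure CGState (n : ℕ) where
  x : EuclideanSpace ℝ (Fin n)
  r : EuclideanSpace ℝ (Fin n)
  p : EuclideanSpace ℝ (Fin n)

/-- Initialization of conjugate gradient for `A x = b` at `x = 0`, so that `r = -b`, `p = -r`. -/
noncomputable def CGState.init {n : ℕ} (b : EuclideanSpace ℝ (Fin n)) : CGState n where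
  x := 0
  r := -b
  p := b

/-- Update of the conjugate gradient state, where `w` is the product `A p`. -/
noncomputable def CGState.update {n : ℕ} (st : CGState n) (w : EuclideanSpace ℝ (Fin n)) :
    CGState n :=
  let α : ℝ := inner ℝ st.r st.r / inner ℝ st.p w
  let r' := st.r + α • w
  let β : ℝ := inner ℝ r' r' / inner ℝ st.r st.r
  { x := st.x + α • st.p
    r := r'
    p := -r' + β • st.p }

open Classical in
/-- One conjugate gradient iteration: nothing more is done once the residual vanishes. -/
noncomputable def cgIteration {n : ℕ} (st : CGState n) :
    MatVecProg (EuclideanSpace ℝ (Fin n)) (CGState n) :=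
  if st.r = 0 then .done st else .mul st.p (fun w => .done (st.update w))

/-- The first `q` iterations of conjugate gradient for `A x = b`, started at zero. -/
noncomputable def conjugateGradient {n : ℕ} (b : EuclideanSpace ℝ (Fin n)) :
    ℕ → MatVecProg (EuclideanSpace ℝ (Fin n)) (CGState n)
  | 0 => .done (CGState.init b)
  | q + 1 => (conjugateGradient b q).bind cgIteration

/-- The spectral norm of a real square matrix. -/
noncomputable def matrixSpectralNorm {n : ℕ} (H : Matrix (Fin n) (Fin n) ℝ) : ℝ :=
  ‖Matrix.toEuclideanCLM (𝕜 := ℝ) H‖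

/-- Multiplication of a vector by `H + γ I`. -/
noncomputable def regularizedMul {n : ℕ} (H : Matrix (Fin n) (Fin n) ℝ) (γ : ℝ)
    (v : EuclideanSpace ℝ (Fin n)) : EuclideanSpace ℝ (Fin n) :=
  Matrix.toEuclideanCLM (𝕜 := ℝ) (H + γ • (1 : Matrix (Fin n) (Fin n) ℝ)) v

/-- The inexactness condition with tolerance `θ` for a step `s`:
`(H + γ I) s = -g + t` with `‖t‖ ≤ θ √(γ / (‖H‖ + γ)) ‖g‖`. -/
def IsInexactStep {n : ℕ} (H : Matrix (Fin n) (Fin n) ℝ) (γ : ℝ)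
    (g : EuclideanSpace ℝ (Fin n)) (θ : ℝ) (s : EuclideanSpace ℝ (Fin n)) : Prop :=
  ∃ t : EuclideanSpace ℝ (Fin n), regularizedMul H γ s = -g + t ∧
    ‖t‖ ≤ θ * Real.sqrt (γ / (matrixSpectralNorm H + γ)) * ‖g‖

/-- The quantity `κ = (‖H‖ + γ) / γ`. -/
noncomputable def kappa {n : ℕ} (H : Matrix (Fin n) (Fin n) ℝ) (γ : ℝ) : ℝ :=
  (matrixSpectralNorm H + γ) / γ

/-! Put `A = H + γI`, with spectrum in `[γ, ‖H‖ + γ]` and `A z = b`. While residuals are nonzero,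
the search directions are `A`-conjugate, so the error energy at step `k` is at most that of `p(A) z`
for every `p` of degree at most `k` with `p(0) = 1` (`cgState_energy_le`). A rescaled Chebyshev
polynomial makes `|p| ≤ 2 exp(-2k/√κ)` on the spectrum (`exists_polynomial_abs_eval_le`). Passing
from energy to residual norm costs a factor `√κ` (`norm_cgState_r_le`), and the stated `k` brings
the result below `θ/√κ`. Residuals are also mutually orthogonal, so one of the first `n + 1`
vanishes (`exists_cgState_r_eq_zero`). The smaller of the two counts serves as `q`; no earlier
residual vanishes, so each iteration costs exactly one product. -/

namespace MatVecProg

theorem output_bind {V α β : Type} (A : V → V) (m : MatVecProg V α) (f : α → MatVecProg V β) :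
    (m.bind f).output A = (f (m.output A)).output A := by
  induction m with
  | done a => rfl
  | mul v cont ih => exact ih (A v)

theorem products_bind {V α β : Type} (A : V → V) (m : MatVecProg V α)
    (f : α → MatVecProg V β) :
    (m.bind f).products A = m.products A + (f (m.output A)).products A := by
  induction m with
  | done a => simp [bind, products, output]
  | mul v cont ih => simp only [bind, products, output, ih]; omega

end MatVecProg

/-! ### Conjugacy, finite termination and energy optimality of conjugate gradient. -/

section ConjugateGradient

variable {n : ℕ} (A : EuclideanSpace ℝ (Fin n) →ₗ[ℝ] EuclideanSpace ℝ (Fin n))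
  (b : EuclideanSpace ℝ (Fin n))

/-- The states of the conjugate gradient recurrence for `A x = b`, without a stopping test. -/
noncomputable def cgState : ℕ → CGState n
  | 0 => CGState.init b
  | k + 1 => (cgState k).update (A (cgState k).p)

theorem conjugateGradient_run (k : ℕ) (hr : ∀ j < k, (cgState A b j).r ≠ 0) :
    (conjugateGradient b k).output A = cgState A b k ∧
      (conjugateGradient b k).products A = k := by
  induction k with
  | zero => exact ⟨rfl, rfl⟩
  | succ k ih =>
    obtain ⟨ho, hp⟩ := ih fun j hj => hr j (by omega)
    have hk := hr k (by omega)
    rw [conjugateGradient, MatVecProg.output_bind, MatVecProg.products_bind, ho, hp, cgIteration,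
      if_neg hk]
    exact ⟨rfl, rfl⟩

/-- The step length of the `k`-th conjugate gradient iteration. -/
noncomputable def cgStep (k : ℕ) : ℝ :=
  inner ℝ (cgState A b k).r (cgState A b k).r / inner ℝ (cgState A b k).p (A (cgState A b k).p)

theorem cgState_x_succ (k : ℕ) :
    (cgState A b (k + 1)).x = (cgState A b k).x + cgStep A b k • (cgState A b k).p := rfl

theorem cgState_r_succ (k : ℕ) :
    (cgState A b (k + 1)).r = (cgState A b k).r + cgStep A b k • A (cgState A b k).p := rfl

theorem cgState_p_succ (k : ℕ) :
    (cgState A b (k + 1)).p = -(cgState A b (k + 1)).r +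
      (inner ℝ (cgState A b (k + 1)).r (cgState A b (k + 1)).r /
        inner ℝ (cgState A b k).r (cgState A b k).r : ℝ) • (cgState A b k).p := rfl

theorem cgState_r_eq (k : ℕ) : (cgState A b k).r = A (cgState A b k).x - b := by
  induction k with
  | zero => simp [cgState, CGState.init]
  | succ k ih =>
    rw [cgState_r_succ, cgState_x_succ, ih, map_add, map_smul]
    abel

/-- The span of the first `k` search directions of conjugate gradient. -/
noncomputable def cgSearchSpace (k : ℕ) : Submodule ℝ (EuclideanSpace ℝ (Fin n)) :=
  Submodule.span ℝ ((fun j => (cgState A b j).p) '' Set.Iio k)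

theorem cgSearchSpace_mono : Monotone (cgSearchSpace A b) := fun _ _ h =>
  Submodule.span_mono (Set.image_mono (Set.Iio_subset_Iio h))

theorem cgState_p_mem {j k : ℕ} (h : j < k) : (cgState A b j).p ∈ cgSearchSpace A b k :=
  Submodule.subset_span ⟨j, h, rfl⟩

theorem cgState_x_mem (k : ℕ) : (cgState A b k).x ∈ cgSearchSpace A b k := by
  induction k with
  | zero => exact Submodule.zero_mem _
  | succ k ih =>
    rw [cgState_x_succ]
    exact add_mem (cgSearchSpace_mono A b k.le_succ ih)
      (Submodule.smul_mem _ _ (cgState_p_mem A b k.lt_succ_self))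

theorem cgState_r_mem (k : ℕ) : (cgState A b k).r ∈ cgSearchSpace A b (k + 1) := by
  cases k with
  | zero => exact neg_mem (cgState_p_mem A b (j := 0) zero_lt_one)
  | succ k =>
    rw [← neg_mem_iff, ← sub_eq_of_eq_add (cgState_p_succ A b k)]
    exact sub_mem (cgState_p_mem A b (by omega))
      (Submodule.smul_mem _ _ (cgState_p_mem A b (by omega)))

theorem inner_eq_zero_of_mem_cgSearchSpace {k : ℕ} {u v : EuclideanSpace ℝ (Fin n)}
    (hu : ∀ j < k, inner ℝ u (cgState A b j).p = 0) (hv : v ∈ cgSearchSpace A b k) :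
    inner ℝ u v = 0 := by
  induction hv using Submodule.span_induction with
  | mem x hx => obtain ⟨j, hj, rfl⟩ := hx; exact hu j hj
  | zero => simp
  | add x y _ _ hx hy => rw [inner_add_right, hx, hy, add_zero]
  | smul a x _ hx => rw [inner_smul_right, hx, mul_zero]

/-- A nonzero step length allows solving the residual recurrence for `A p_j`, a multiple of `r_{j+1}
- r_j`. -/
theorem map_cgState_p_mem {j : ℕ} (h : cgStep A b j ≠ 0) :
    A (cgState A b j).p ∈ cgSearchSpace A b (j + 2) := by
  have : A (cgState A b j).p =
      (cgStep A b j)⁻¹ • ((cgState A b (j + 1)).r - (cgState A b j).r) := by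
    rw [cgState_r_succ, add_sub_cancel_left, inv_smul_smul₀ h]
  rw [this]
  exact Submodule.smul_mem _ _ (sub_mem (cgState_r_mem A b (j + 1))
    (cgSearchSpace_mono A b (by omega) (cgState_r_mem A b j)))

variable {A}

theorem cgStep_ne_zero_of_inner (hpos : ∀ v, v ≠ 0 → 0 < inner ℝ v (A v)) {k : ℕ}
    (hr : (cgState A b k).r ≠ 0)
    (hrp : inner ℝ (cgState A b k).r (cgState A b k).p =
      -inner ℝ (cgState A b k).r (cgState A b k).r) :
    0 < inner ℝ (cgState A b k).p (A (cgState A b k).p) ∧ cgStep A b k ≠ 0 := by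
  have hrr : inner ℝ (cgState A b k).r (cgState A b k).r ≠ 0 := inner_self_ne_zero.2 hr
  have hp : 0 < inner ℝ (cgState A b k).p (A (cgState A b k).p) := by
    refine hpos _ fun h => hrr ?_
    rw [h, inner_zero_right] at hrp
    linarith
  exact ⟨hp, div_ne_zero hrr hp.ne'⟩

/-- The claims need a joint induction: conjugacy gives orthogonality of the next residual, which in
turn gives conjugacy of the next direction. -/
theorem cgState_orthogonality (hA : A.IsSymmetric) (hpos : ∀ v, v ≠ 0 → 0 < inner ℝ v (A v))
    (k : ℕ) (hr : ∀ j < k, (cgState A b j).r ≠ 0) :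
    (∀ j < k, inner ℝ (cgState A b k).r (cgState A b j).p = 0) ∧
    (∀ j < k, inner ℝ (cgState A b k).p (A (cgState A b j).p) = 0) ∧
    inner ℝ (cgState A b k).r (cgState A b k).p =
      -inner ℝ (cgState A b k).r (cgState A b k).r ∧
    ∀ j < k, cgStep A b j ≠ 0 := by
  induction k with
  | zero =>
    refine ⟨by simp, by simp, ?_, by simp⟩
    simp [cgState, CGState.init]
  | succ k ih =>
    obtain ⟨h1, h2, h3, h4⟩ := ih fun j hj => hr j (by omega)
    have hrk := hr k (by omega)
    have hrr : inner ℝ (cgState A b k).r (cgState A b k).r ≠ 0 := inner_self_ne_zero.2 hrk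
    obtain ⟨hp, hα⟩ := cgStep_ne_zero_of_inner b hpos hrk h3
    have hα' : cgStep A b k * inner ℝ (cgState A b k).p (A (cgState A b k).p) =
        inner ℝ (cgState A b k).r (cgState A b k).r := div_mul_cancel₀ _ hp.ne'
    have hstep : ∀ j < k + 1, cgStep A b j ≠ 0 := by
      intro j hj
      obtain hj | rfl := Nat.lt_succ_iff_lt_or_eq.1 hj
      exacts [h4 j hj, hα]
    have horth : ∀ j < k + 1, inner ℝ (cgState A b (k + 1)).r (cgState A b j).p = 0 := by
      intro j hj
      rw [cgState_r_succ, inner_add_left, inner_smul_left, hA]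
      obtain hj | rfl := Nat.lt_succ_iff_lt_or_eq.1 hj
      · simp [h1 j hj, h2 j hj]
      · simp [hα', h3]
    have horth' : ∀ v ∈ cgSearchSpace A b (k + 1), inner ℝ (cgState A b (k + 1)).r v = 0 :=
      fun v hv => inner_eq_zero_of_mem_cgSearchSpace A b horth hv
    refine ⟨horth, ?_, ?_, hstep⟩
    · intro j hj
      rw [cgState_p_succ, inner_add_left, inner_neg_left, inner_smul_left]
      obtain hj | rfl := Nat.lt_succ_iff_lt_or_eq.1 hj
      -- Here `j + 2 ≤ k + 1`, so `A p_j` lies in the space orthogonal to the new residual.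
      · rw [h2 j hj, horth' _ (cgSearchSpace_mono A b (by omega)
          (map_cgState_p_mem A b (h4 j hj)))]
        simp
      -- Consecutive residuals are orthogonal; this is what makes the coefficient `β` cancel the
      -- last term.
      · have e : cgStep A b j * inner ℝ (cgState A b (j + 1)).r (A (cgState A b j).p) =
            inner ℝ (cgState A b (j + 1)).r (cgState A b (j + 1)).r := by
          rw [← inner_smul_right, ← sub_eq_of_eq_add' (cgState_r_succ A b j), inner_sub_right,
            horth' _ (cgState_r_mem A b j), sub_zero]
        rw [← e, ← hα']
        simp only [conj_trivial]
        field_simp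
        ring
    · conv_lhs => rw [cgState_p_succ]
      rw [inner_add_right, inner_neg_right, inner_smul_right, horth k (by omega), mul_zero,
        add_zero]

/-- Otherwise `n + 1` nonzero orthogonal residuals would be independent in dimension `n`. -/
theorem exists_cgState_r_eq_zero (hA : A.IsSymmetric)
    (hpos : ∀ v, v ≠ 0 → 0 < inner ℝ v (A v)) :
    ∃ k ≤ n, (cgState A b k).r = 0 := by
  by_contra! h
  have hlt : ∀ i j : ℕ, i < j → j ≤ n → inner ℝ (cgState A b j).r (cgState A b i).r = 0 := by
    intro i j hij hj
    refine inner_eq_zero_of_mem_cgSearchSpace A b (k := j) ?_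
      (cgSearchSpace_mono A b hij (cgState_r_mem A b i))
    exact (cgState_orthogonality b hA hpos j fun i hi => h i (by omega)).1
  have hli : LinearIndependent ℝ fun i : Fin (n + 1) => (cgState A b i).r := by
    refine linearIndependent_of_ne_zero_of_inner_eq_zero (fun i => h i (by omega)) ?_
    intro i j hij
    obtain hij | hij := lt_or_gt_of_ne (Fin.val_ne_of_ne hij)
    · rw [real_inner_comm]
      exact hlt i j hij (by omega)
    · exact hlt j i hij (by omega)
  simpa using hli.fintype_card_le_finrank

theorem map_mem_cgSearchSpace {k : ℕ} (hα : ∀ j < k, cgStep A b j ≠ 0)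
    {v : EuclideanSpace ℝ (Fin n)} (hv : v ∈ cgSearchSpace A b k) :
    A v ∈ cgSearchSpace A b (k + 1) := by
  induction hv using Submodule.span_induction with
  | mem x hx =>
    obtain ⟨j, hj, rfl⟩ := hx
    have hj' : j < k := hj
    exact cgSearchSpace_mono A b (by omega) (map_cgState_p_mem A b (hα j hj))
  | zero => simp
  | add x y _ _ hx hy => rw [map_add]; exact add_mem hx hy
  | smul a x _ hx => rw [map_smul]; exact Submodule.smul_mem _ _ hx

theorem pow_apply_mem_cgSearchSpace (i : ℕ) (hα : ∀ j < i, cgStep A b j ≠ 0) :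
    (A ^ i) b ∈ cgSearchSpace A b (i + 1) := by
  induction i with
  | zero => exact cgState_p_mem A b (j := 0) zero_lt_one
  | succ i ih =>
    rw [pow_succ', Module.End.mul_apply]
    exact map_mem_cgSearchSpace b hα (ih fun j hj => hα j (by omega))

theorem aeval_apply_mem_cgSearchSpace {k : ℕ} (hα : ∀ j < k, cgStep A b j ≠ 0)
    (p : Polynomial ℝ) (hp : p.degree < k) :
    Polynomial.aeval A p b ∈ cgSearchSpace A b k := by
  rw [Polynomial.aeval_eq_sum_range, LinearMap.sum_apply]
  refine sum_mem fun i _ => ?_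
  rw [LinearMap.smul_apply]
  by_cases hi : i < k
  · exact Submodule.smul_mem _ _ (cgSearchSpace_mono A b (by omega)
      (pow_apply_mem_cgSearchSpace b i fun j hj => hα j (by omega)))
  · rw [Polynomial.coeff_eq_zero_of_degree_lt (hp.trans_le (by exact_mod_cast not_lt.1 hi)),
      zero_smul]
    exact Submodule.zero_mem _

/-- Conjugate gradient minimizes the energy norm of the error over all polynomials in `A` applied
to the initial error, normalized at `0`. -/
theorem cgState_energy_le (hA : A.IsSymmetric) (hpos : ∀ v, v ≠ 0 → 0 < inner ℝ v (A v))
    (k : ℕ) (hr : ∀ j < k, (cgState A b j).r ≠ 0) (z : EuclideanSpace ℝ (Fin n)) (hz : A z = b)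
    (p : Polynomial ℝ) (hp : p.natDegree ≤ k) (hp0 : p.eval 0 = 1) :
    inner ℝ ((cgState A b k).x - z) (A ((cgState A b k).x - z)) ≤
      inner ℝ (Polynomial.aeval A p z) (A (Polynomial.aeval A p z)) := by
  obtain ⟨h1, -, -, h4⟩ := cgState_orthogonality b hA hpos k hr
  set e := (cgState A b k).x - z with he
  have hAe : A e = (cgState A b k).r := by rw [he, map_sub, hz, cgState_r_eq]
  -- Since `p = X * divX p + 1` and `A z = b`, the vector `p(A) z` differs from `z` by a Krylov
  -- vector.
  have hpz : Polynomial.aeval A p z = Polynomial.aeval A p.divX b + z := by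
    conv_lhs => rw [← p.divX_mul_X_add]
    rw [Polynomial.coeff_zero_eq_eval_zero, hp0]
    simp [Module.End.mul_apply, hz]
  have hmem : Polynomial.aeval A p.divX b ∈ cgSearchSpace A b k := by
    rcases Nat.eq_zero_or_pos k with rfl | hk
    · have : p.divX = 0 := Polynomial.divX_eq_zero_iff.2 (Polynomial.eq_C_of_natDegree_le_zero hp)
      rw [this, map_zero]
      exact Submodule.zero_mem _
    · refine aeval_apply_mem_cgSearchSpace b h4 _ ?_
      refine (Polynomial.degree_le_natDegree).trans_lt ?_
      rw [Polynomial.natDegree_divX_eq_natDegree_tsub_one]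
      exact_mod_cast (by omega : p.natDegree - 1 < k)
  -- `p(A) z = d - e` with `d` in the search space, hence energy-orthogonal to `e`: Pythagoras
  -- concludes.
  set d := Polynomial.aeval A p.divX b + (cgState A b k).x with hd
  have hde : inner ℝ (A e) d = 0 := by
    rw [hAe]
    exact inner_eq_zero_of_mem_cgSearchSpace A b h1 (add_mem hmem (cgState_x_mem A b k))
  have hsplit : Polynomial.aeval A p z = d - e := by
    rw [hpz, hd, he]
    abel
  have hdd : 0 ≤ inner ℝ d (A d) := by
    by_cases h : d = 0
    · simp [h]
    · exact (hpos d h).le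
  have hed : inner ℝ e (A d) = 0 := by rw [← hA, hde]
  have hexpand : inner ℝ (d - e) (A (d - e)) = inner ℝ d (A d) + inner ℝ e (A e) := by
    rw [map_sub, inner_sub_left, inner_sub_right, inner_sub_right, hed,
      real_inner_comm (A e) d, hde]
    ring
  rw [hsplit, hexpand]
  linarith

end ConjugateGradient

/-! ### Chebyshev polynomials rescaled to the spectral interval. -/

section Chebyshev

open Polynomial

theorem half_exp_le_cosh (x : ℝ) : Real.exp x / 2 ≤ Real.cosh x := by
  rw [Real.cosh_eq]
  linarith [Real.exp_pos (-x)]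

theorem two_div_le_log_div {s : ℝ} (hs : 1 < s) :
    2 / s ≤ Real.log ((s + 1) / (s - 1)) := by
  have hs' : 0 < s - 1 := by linarith
  have h := Real.le_log_one_add_of_nonneg (x := 2 / (s - 1)) (by positivity)
  have e1 : 2 * (2 / (s - 1)) / (2 / (s - 1) + 2) = 2 / s := by
    rw [div_add' _ _ _ hs'.ne']
    field_simp
    ring
  have e2 : 1 + 2 / (s - 1) = (s + 1) / (s - 1) := by
    field_simp
    ring
  rwa [e1, e2] at h

/-- A polynomial of degree at most `k`, normalized at `0`, that is small on `[a, c]`. -/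
theorem exists_polynomial_abs_eval_le {a c : ℝ} (ha : 0 < a) (hac : a ≤ c) {k : ℕ} (hk : k ≠ 0) :
    ∃ p : ℝ[X], p.natDegree ≤ k ∧ p.eval 0 = 1 ∧
      ∀ x ∈ Set.Icc a c, |p.eval x| ≤ 2 * Real.exp (-(2 * k / √(c / a))) := by
  -- When `a = c` the rescaling degenerates, but `1 - x/a` vanishes at the only point.
  rcases hac.eq_or_lt with rfl | hac
  · refine ⟨1 - C a⁻¹ * X, ?_, by simp, ?_⟩
    · compute_degree
      omega
    · rintro x ⟨h1, h2⟩
      obtain rfl := le_antisymm h1 h2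
      simp [ha.ne']
      positivity
  set s := √(c / a) with hs
  have hs1 : 1 < s := by
    rw [hs, Real.lt_sqrt zero_le_one, lt_div_iff₀ ha]
    linarith
  have hc : c = s ^ 2 * a := by
    rw [hs, Real.sq_sqrt (div_pos (ha.trans hac) ha).le, div_mul_cancel₀ _ ha.ne']
  have hs' : 0 < s - 1 := by linarith
  have hs2 : 0 < s + 1 := by linarith
  have hca : 0 < c - a := by linarith
  -- Chosen so that `cosh t` is the image of `0` under the affine map of `[a, c]` onto `[-1, 1]`;
  -- there `T_k` equals `cosh (k t)`, the normalizing constant `D`.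
  set t := Real.log ((s + 1) / (s - 1)) with ht
  have hexp : Real.exp t = (s + 1) / (s - 1) := Real.exp_log (by positivity)
  have hcosh : Real.cosh t = (c + a) / (c - a) := by
    have : (c - a) = (s - 1) * (s + 1) * a := by rw [hc]; ring
    rw [Real.cosh_eq, Real.exp_neg, hexp, this, hc]
    field_simp
    ring
  set D := Real.cosh ((k : ℤ) * t) with hD
  have hDlow : Real.exp (2 * k / s) / 2 ≤ D := by
    refine le_trans ?_ (half_exp_le_cosh _)
    gcongr
    have := mul_le_mul_of_nonneg_left (two_div_le_log_div hs1) (Nat.cast_nonneg (α := ℝ) k)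
    push_cast
    calc 2 * (k : ℝ) / s = k * (2 / s) := by ring
      _ ≤ k * t := this
  have hDpos : 0 < D := Real.cosh_pos _
  refine ⟨C D⁻¹ * (Chebyshev.T ℝ k).comp (C ((c + a) / (c - a)) - C (2 / (c - a)) * X),
    ?_, ?_, ?_⟩
  · refine (natDegree_C_mul_le _ _).trans (natDegree_comp_le.trans ?_)
    have h1 : (Chebyshev.T ℝ k).natDegree = k := by simp
    have h2 : (C ((c + a) / (c - a)) - C (2 / (c - a)) * X : ℝ[X]).natDegree ≤ 1 := by
      compute_degree
    rw [h1]
    nlinarith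
  · simp only [eval_mul, eval_C, eval_comp, eval_sub, eval_X, mul_zero, sub_zero]
    rw [← hcosh, Chebyshev.T_real_cosh]
    exact inv_mul_cancel₀ hDpos.ne'
  · rintro x ⟨h1, h2⟩
    simp only [eval_mul, eval_C, eval_comp, eval_sub, eval_X]
    have hx : |(c + a) / (c - a) - 2 / (c - a) * x| ≤ 1 := by
      rw [show (c + a) / (c - a) - 2 / (c - a) * x = (c + a - 2 * x) / (c - a) by ring,
        abs_div, abs_of_pos hca, div_le_one hca, abs_le]
      constructor <;> linarith
    rw [abs_mul, abs_of_pos (inv_pos.2 hDpos)]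
    calc D⁻¹ * |(Chebyshev.T ℝ k).eval ((c + a) / (c - a) - 2 / (c - a) * x)| ≤ D⁻¹ * 1 := by
          gcongr
          exact Chebyshev.abs_eval_T_real_le_one _ hx
      _ ≤ (Real.exp (2 * k / s) / 2)⁻¹ := by
          rw [mul_one]
          gcongr
      _ = _ := by
          rw [Real.exp_neg]
          field_simp

end Chebyshev

/-! ### Eigenbasis estimates, compared term by term, and the residual bound. -/

section Spectral

open Polynomial

variable {n : ℕ} {A : EuclideanSpace ℝ (Fin n) →ₗ[ℝ] EuclideanSpace ℝ (Fin n)}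

theorem repr_aeval_eigenvectorBasis (hA : A.IsSymmetric) (p : ℝ[X])
    (v : EuclideanSpace ℝ (Fin n)) (i : Fin n) :
    (hA.eigenvectorBasis finrank_euclideanSpace_fin).repr (aeval A p v) i =
      p.eval (hA.eigenvalues finrank_euclideanSpace_fin i) *
        (hA.eigenvectorBasis finrank_euclideanSpace_fin).repr v i := by
  induction p using Polynomial.induction_on' with
  | add p q hp hq => simp [hp, hq, add_mul]
  | monomial k c =>
    have h : ∀ k : ℕ, (hA.eigenvectorBasis finrank_euclideanSpace_fin).repr ((A ^ k) v) i =
        hA.eigenvalues finrank_euclideanSpace_fin i ^ k *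
          (hA.eigenvectorBasis finrank_euclideanSpace_fin).repr v i := by
      intro k
      induction k with
      | zero => simp
      | succ k ih =>
        rw [pow_succ', Module.End.mul_apply, hA.eigenvectorBasis_apply_self_apply, ih, pow_succ']
        simp [mul_assoc]
    rw [aeval_monomial, Module.End.mul_apply, Module.algebraMap_end_apply, map_smul,
      PiLp.smul_apply, h, eval_monomial, smul_eq_mul, mul_assoc]

theorem eigenvalues_mem_Icc (hA : A.IsSymmetric) {a c : ℝ}
    (hlow : ∀ v, a * ‖v‖ ^ 2 ≤ inner ℝ v (A v)) (hup : ∀ v, inner ℝ v (A v) ≤ c * ‖v‖ ^ 2)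
    (i : Fin n) : hA.eigenvalues finrank_euclideanSpace_fin i ∈ Set.Icc a c := by
  have h := hA.apply_eigenvectorBasis finrank_euclideanSpace_fin i
  have h1 := hlow (hA.eigenvectorBasis finrank_euclideanSpace_fin i)
  have h2 := hup (hA.eigenvectorBasis finrank_euclideanSpace_fin i)
  rw [h, inner_smul_right, real_inner_self_eq_norm_sq] at h1 h2
  simpa using And.intro h1 h2

theorem inner_eq_sum_eigenvectorBasis (hA : A.IsSymmetric) (v : EuclideanSpace ℝ (Fin n)) :
    inner ℝ v (A v) = ∑ i, hA.eigenvalues finrank_euclideanSpace_fin i *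
      (hA.eigenvectorBasis finrank_euclideanSpace_fin).repr v i ^ 2 := by
  rw [← (hA.eigenvectorBasis finrank_euclideanSpace_fin).repr.inner_map_map, PiLp.inner_apply]
  refine Finset.sum_congr rfl fun i _ => ?_
  rw [hA.eigenvectorBasis_apply_self_apply]
  simp
  ring

theorem norm_map_sq_eq_sum_eigenvectorBasis (hA : A.IsSymmetric)
    (v : EuclideanSpace ℝ (Fin n)) :
    ‖A v‖ ^ 2 = ∑ i, hA.eigenvalues finrank_euclideanSpace_fin i ^ 2 *
      (hA.eigenvectorBasis finrank_euclideanSpace_fin).repr v i ^ 2 := by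
  rw [← (hA.eigenvectorBasis finrank_euclideanSpace_fin).repr.norm_map,
    EuclideanSpace.real_norm_sq_eq]
  refine Finset.sum_congr rfl fun i _ => ?_
  rw [hA.eigenvectorBasis_apply_self_apply]
  simp
  ring

theorem inner_aeval_le (hA : A.IsSymmetric) {a c : ℝ} (ha : 0 < a)
    (hlow : ∀ v, a * ‖v‖ ^ 2 ≤ inner ℝ v (A v)) (hup : ∀ v, inner ℝ v (A v) ≤ c * ‖v‖ ^ 2)
    (p : ℝ[X]) {M : ℝ} (hM : ∀ x ∈ Set.Icc a c, |p.eval x| ≤ M)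
    (v : EuclideanSpace ℝ (Fin n)) :
    inner ℝ (aeval A p v) (A (aeval A p v)) ≤ M ^ 2 * inner ℝ v (A v) := by
  rw [inner_eq_sum_eigenvectorBasis hA, inner_eq_sum_eigenvectorBasis hA, Finset.mul_sum]
  refine Finset.sum_le_sum fun i _ => ?_
  have hi := eigenvalues_mem_Icc hA hlow hup i
  have hp : p.eval (hA.eigenvalues finrank_euclideanSpace_fin i) ^ 2 ≤ M ^ 2 := by
    rw [← sq_abs]
    gcongr
    exact hM _ hi
  have h0 : 0 ≤ hA.eigenvalues finrank_euclideanSpace_fin i := ha.le.trans hi.1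
  rw [repr_aeval_eigenvectorBasis, mul_pow]
  calc _ = p.eval (hA.eigenvalues finrank_euclideanSpace_fin i) ^ 2 *
        (hA.eigenvalues finrank_euclideanSpace_fin i *
          (hA.eigenvectorBasis finrank_euclideanSpace_fin).repr v i ^ 2) := by ring
    _ ≤ _ := by gcongr

theorem norm_map_sq_le (hA : A.IsSymmetric) {a c : ℝ} (ha : 0 < a)
    (hlow : ∀ v, a * ‖v‖ ^ 2 ≤ inner ℝ v (A v)) (hup : ∀ v, inner ℝ v (A v) ≤ c * ‖v‖ ^ 2)
    (v : EuclideanSpace ℝ (Fin n)) : ‖A v‖ ^ 2 ≤ c * inner ℝ v (A v) := by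
  rw [inner_eq_sum_eigenvectorBasis hA, norm_map_sq_eq_sum_eigenvectorBasis hA, Finset.mul_sum]
  refine Finset.sum_le_sum fun i _ => ?_
  have hi := eigenvalues_mem_Icc hA hlow hup i
  have h0 : 0 ≤ hA.eigenvalues finrank_euclideanSpace_fin i := ha.le.trans hi.1
  rw [← mul_assoc, sq (hA.eigenvalues _ i)]
  gcongr
  exact hi.2

theorem mul_inner_le_norm_map_sq (hA : A.IsSymmetric) {a c : ℝ} (ha : 0 < a)
    (hlow : ∀ v, a * ‖v‖ ^ 2 ≤ inner ℝ v (A v)) (hup : ∀ v, inner ℝ v (A v) ≤ c * ‖v‖ ^ 2)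
    (v : EuclideanSpace ℝ (Fin n)) : a * inner ℝ v (A v) ≤ ‖A v‖ ^ 2 := by
  rw [inner_eq_sum_eigenvectorBasis hA, norm_map_sq_eq_sum_eigenvectorBasis hA, Finset.mul_sum]
  refine Finset.sum_le_sum fun i _ => ?_
  have hi := eigenvalues_mem_Icc hA hlow hup i
  have h0 : 0 ≤ hA.eigenvalues finrank_euclideanSpace_fin i := ha.le.trans hi.1
  rw [← mul_assoc, sq (hA.eigenvalues _ i)]
  gcongr
  exact hi.1

/-- The residual bound for conjugate gradient in terms of the condition number. -/
theorem norm_cgState_r_le (b : EuclideanSpace ℝ (Fin n)) (hA : A.IsSymmetric) {a c : ℝ}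
    (ha : 0 < a) (hac : a ≤ c)
    (hlow : ∀ v, a * ‖v‖ ^ 2 ≤ inner ℝ v (A v)) (hup : ∀ v, inner ℝ v (A v) ≤ c * ‖v‖ ^ 2)
    {k : ℕ} (hk : k ≠ 0) (hr : ∀ j < k, (cgState A b j).r ≠ 0) :
    ‖(cgState A b k).r‖ ≤ √(c / a) * (2 * Real.exp (-(2 * k / √(c / a)))) * ‖b‖ := by
  have hpos : ∀ v, v ≠ 0 → 0 < inner ℝ v (A v) := fun v hv =>
    lt_of_lt_of_le (by positivity) (hlow v)
  have hinj : Function.Injective A := by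
    refine (injective_iff_map_eq_zero A).2 fun v hv => ?_
    by_contra h
    simpa [hv] using hpos v h
  obtain ⟨z, hz⟩ := LinearMap.surjective_of_injective hinj b
  obtain ⟨p, hp, hp0, hpM⟩ := exists_polynomial_abs_eval_le ha hac hk
  set M := 2 * Real.exp (-(2 * k / √(c / a))) with hM
  have hM0 : 0 ≤ M := by positivity
  have hc : 0 < c := ha.trans_le hac
  have h1 := cgState_energy_le b hA hpos k hr z hz p hp hp0
  have h2 := inner_aeval_le hA ha hlow hup p hpM z
  have h3 := norm_map_sq_le hA ha hlow hup ((cgState A b k).x - z)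
  have h4 := mul_inner_le_norm_map_sq hA ha hlow hup z
  have hAe : A ((cgState A b k).x - z) = (cgState A b k).r := by
    rw [map_sub, hz, cgState_r_eq]
  rw [hAe] at h3 h1
  rw [hz] at h4 h2
  refine le_of_sq_le_sq ?_ (by positivity)
  rw [mul_pow, mul_pow, Real.sq_sqrt (by positivity)]
  -- The two norm conversions cost `c` for the error and `1 / a` for `z`, whence the factor `√(c /
  -- a)`.
  calc ‖(cgState A b k).r‖ ^ 2 ≤ c * (M ^ 2 * inner ℝ z b) :=
        h3.trans (mul_le_mul_of_nonneg_left (h1.trans h2) hc.le)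
    _ = c / a * M ^ 2 * (a * inner ℝ z b) := by field_simp
    _ ≤ c / a * M ^ 2 * ‖b‖ ^ 2 := by gcongr

end Spectral

/-! ### The regularized matrix and the iteration count. -/

section Regularized

variable {n : ℕ} {H : Matrix (Fin n) (Fin n) ℝ} {γ : ℝ}

theorem regularizedMul_apply (v : EuclideanSpace ℝ (Fin n)) :
    regularizedMul H γ v = Matrix.toEuclideanCLM (𝕜 := ℝ) H v + γ • v := by
  simp [regularizedMul, map_add, map_smul]

theorem inner_regularizedMul (v : EuclideanSpace ℝ (Fin n)) :
    inner ℝ v (regularizedMul H γ v) =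
      inner ℝ v (Matrix.toEuclideanCLM (𝕜 := ℝ) H v) + γ * ‖v‖ ^ 2 := by
  rw [regularizedMul_apply, inner_add_right, inner_smul_right, real_inner_self_eq_norm_sq]

theorem le_inner_regularizedMul (hH : H.PosSemidef) (v : EuclideanSpace ℝ (Fin n)) :
    γ * ‖v‖ ^ 2 ≤ inner ℝ v (regularizedMul H γ v) := by
  have h := (Matrix.isPositive_toEuclideanLin_iff.2 hH).re_inner_nonneg_right v
  have h' : 0 ≤ inner ℝ v (Matrix.toEuclideanCLM (𝕜 := ℝ) H v) := h
  rw [inner_regularizedMul]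
  linarith

theorem inner_regularizedMul_le (v : EuclideanSpace ℝ (Fin n)) :
    inner ℝ v (regularizedMul H γ v) ≤ (matrixSpectralNorm H + γ) * ‖v‖ ^ 2 := by
  have h1 := real_inner_le_norm v (Matrix.toEuclideanCLM (𝕜 := ℝ) H v)
  have h2 := (Matrix.toEuclideanCLM (𝕜 := ℝ) H).le_opNorm v
  rw [inner_regularizedMul, matrixSpectralNorm]
  nlinarith [norm_nonneg v]

theorem isSymmetric_regularized (hH : H.PosSemidef) :
    (Matrix.toEuclideanLin (𝕜 := ℝ)
      (H + γ • (1 : Matrix (Fin n) (Fin n) ℝ))).IsSymmetric := by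
  rw [Matrix.isSymmetric_toEuclideanLin_iff]
  refine hH.isHermitian.add ?_
  rw [Matrix.IsHermitian, Matrix.conjTranspose_smul, Matrix.conjTranspose_one, star_trivial]

end Regularized

/-- In `2κ/θ`, the `2` is the Chebyshev constant, one `√κ` comes from the norm conversion and the
other from the tolerance. -/
theorem two_mul_exp_le_of_le {κ θ k : ℝ} (hκ : 1 ≤ κ) (hθ : 0 < θ)
    (hk : 1 / 2 * √κ * Real.log (2 * κ / θ) ≤ k) :
    √κ * (2 * Real.exp (-(2 * k / √κ))) ≤ θ * √κ⁻¹ := by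
  have hs : 0 < √κ := Real.sqrt_pos.2 (by linarith)
  have hsq : √κ * √κ = κ := Real.mul_self_sqrt (by linarith)
  have hlog : Real.log (2 * κ / θ) ≤ 2 * k / √κ := by
    rw [le_div_iff₀ hs]
    linarith
  have hexp : Real.exp (-(2 * k / √κ)) ≤ θ / (2 * κ) := by
    calc Real.exp (-(2 * k / √κ)) ≤ Real.exp (-Real.log (2 * κ / θ)) := by gcongr
      _ = θ / (2 * κ) := by
        rw [Real.exp_neg, Real.exp_log (by positivity), inv_div]
  calc √κ * (2 * Real.exp (-(2 * k / √κ))) ≤ √κ * (2 * (θ / (2 * κ))) := by gcongr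
    _ = θ * √κ⁻¹ := by
      rw [Real.sqrt_inv]
      nth_rewrite 2 [← hsq]
      field_simp

theorem proposition1 (n : ℕ) (H : Matrix (Fin n) (Fin n) ℝ) (hH : H.PosSemidef)
    (γ : ℝ) (hγ : 0 < γ) (g : EuclideanSpace ℝ (Fin n))
    (θ : ℝ) (hθ0 : 0 ≤ θ) (hθ1 : θ < 1) :
    ∃ q : ℕ,
      IsInexactStep H γ g θ ((conjugateGradient (-g) q).output (regularizedMul H γ)).x ∧
      (conjugateGradient (-g) q).products (regularizedMul H γ) = q ∧
      q ≤ n ∧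
      (0 < θ →
        q ≤ ⌈(1 / 2 : ℝ) * Real.sqrt (kappa H γ) * Real.log (2 * kappa H γ / θ)⌉₊) := by
  classical
  set A := Matrix.toEuclideanLin (𝕜 := ℝ) (H + γ • (1 : Matrix (Fin n) (Fin n) ℝ)) with hAdef
  have hmul : regularizedMul H γ = A := rfl
  have hA : A.IsSymmetric := isSymmetric_regularized hH
  have hlow : ∀ v, γ * ‖v‖ ^ 2 ≤ inner ℝ v (A v) := le_inner_regularizedMul hH
  have hup : ∀ v, inner ℝ v (A v) ≤ (matrixSpectralNorm H + γ) * ‖v‖ ^ 2 :=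
    inner_regularizedMul_le
  have hpos : ∀ v, v ≠ 0 → 0 < inner ℝ v (A v) := fun v hv =>
    lt_of_lt_of_le (by positivity) (hlow v)
  have hL : 0 ≤ matrixSpectralNorm H := norm_nonneg _
  have hκ : 1 ≤ kappa H γ := by
    rw [kappa, le_div_iff₀ hγ]
    linarith
  have hinv : γ / (matrixSpectralNorm H + γ) = (kappa H γ)⁻¹ := by rw [kappa, inv_div]
  have key : ∀ q, (∀ j < q, (cgState A (-g) j).r ≠ 0) →
      ‖(cgState A (-g) q).r‖ ≤ θ * √(γ / (matrixSpectralNorm H + γ)) * ‖g‖ →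
      IsInexactStep H γ g θ ((conjugateGradient (-g) q).output (regularizedMul H γ)).x ∧
      (conjugateGradient (-g) q).products (regularizedMul H γ) = q := by
    intro q hq hle
    obtain ⟨ho, hp⟩ := conjugateGradient_run A (-g) q hq
    rw [hmul, ho, hp]
    refine ⟨⟨(cgState A (-g) q).r, ?_, hle⟩, rfl⟩
    rw [hmul, cgState_r_eq]
    abel
  have hex : ∃ k, (cgState A (-g) k).r = 0 := by
    obtain ⟨k, -, hk⟩ := exists_cgState_r_eq_zero (-g) hA hpos
    exact ⟨k, hk⟩
  have hmn : Nat.find hex ≤ n := by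
    obtain ⟨k, hkn, hk⟩ := exists_cgState_r_eq_zero (-g) hA hpos
    exact (Nat.find_min' hex hk).trans hkn
  have hmin : ∀ j < Nat.find hex, (cgState A (-g) j).r ≠ 0 := fun j hj => Nat.find_min hex hj
  set N := ⌈(1 / 2 : ℝ) * √(kappa H γ) * Real.log (2 * kappa H γ / θ)⌉₊ with hN
  -- For `θ = 0` division by zero and `log 0 = 0` give `N = 0`, so positivity must be part of the
  -- test.
  by_cases h : 0 < θ ∧ N < Nat.find hex
  · obtain ⟨hθ, hNm⟩ := h
    -- The residual bound excludes `k = 0`; here `2κ/θ > 1` because `θ < 1 ≤ κ`.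
    have hN0 : N ≠ 0 := by
      rw [hN, Ne, Nat.ceil_eq_zero, not_le]
      have : 0 < Real.log (2 * kappa H γ / θ) := by
        refine Real.log_pos ?_
        rw [lt_div_iff₀ hθ]
        linarith
      have : 0 < √(kappa H γ) := Real.sqrt_pos.2 (by linarith)
      positivity
    have hr : ∀ j < N, (cgState A (-g) j).r ≠ 0 := fun j hj => hmin j (hj.trans hNm)
    have hbound := norm_cgState_r_le (-g) hA hγ (by linarith) hlow hup hN0 hr
    have hdecay := two_mul_exp_le_of_le hκ hθ (Nat.le_ceil _)
    obtain ⟨h1, h2⟩ := key N hr (by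
      rw [norm_neg] at hbound
      rw [hinv]
      exact hbound.trans (mul_le_mul_of_nonneg_right hdecay (norm_nonneg g)))
    exact ⟨N, h1, h2, by omega, fun _ => le_rfl⟩
  · obtain ⟨h1, h2⟩ := key (Nat.find hex) hmin (by
      rw [Nat.find_spec hex, norm_zero]
      positivity)
    refine ⟨Nat.find hex, h1, h2, hmn, fun hθ => ?_⟩
    by_contra hlt
    exact h ⟨hθ, not_le.1 hlt⟩
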